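/- For $u\in L^2(\mathbb R^3;\mathbb R)$ let $\hat u(\xi)=\int e^{-2\pi i\xi\cdot x}u(x)\,dx$ (extended to $L^2$), $\|u\|^2_{H^{1/2}}=\int_{\mathbb R^3}(1+2\pi|\xi|)|\hat u(\xi)|^2d\xi$, $H^{1/2}=\{u\in L^2(\mathbb R^3;\mathbb R):\|u\|_{H^{1/2}}<\infty\}$ and $\phi_u(x)=\int_{\mathbb R^3}\frac{u(y)^2}{|x-y|}\,dy$. Solutions in $H^{1/2}$ are understood in the weak sense (tested against all $w\in H^{1/2}$, with $\sqrt{-\Delta}$ the Fourier multiplier $2\pi|\xi|$). Let $Q$ be a ground state solution of $\sqrt{-\Delta}\,u+u=\phi_u u$ in $H^{1/2}$, that is, a solution which minimizes $\frac12\|u\|^2_{H^{1/2}}-\frac14\int\phi_u u^2dx$ over $\{u\in H^{1/2}: u\neq0,\ \|u\|^2_{H^{1/2}}=\int\phi_u u^2dx\}$ and belongs to this set (for instance a positive radially symmetric one). Let $a,\beta>0$, $a\ne\beta$, and consider the system $$\sqrt{-\Delta}\,u+u=a\phi_u u+\beta\phi_v u,\qquad \sqrt{-\Delta}\,v+v=a\phi_v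 v+\beta\phi_u v,\qquad (u,v)\in H^{1/2}\times H^{1/2},$$ with energy $$J(u,v)=\tfrac12\big(\|u\|^2_{H^{1/2}}+\|v\|^2_{H^{1/2}}\big)-\tfrac14\int_{\mathbb R^3}\big(a\phi_u u^2+a\phi_v v^2+2\beta\phi_u v^2\big)dx$$ and Nehari manifold $$\mathcal N=\Big\{(u,v)\in H^{1/2}\times H^{1/2}:\ u\ne0,\ v\neq 0,\ \|u\|^2_{H^{1/2}}=\int(a\phi_u u^2+\beta\phi_v u^2)dx,\ \|v\|^2_{H^{1/2}}=\int(a\phi_v v^2+\beta\phi_u v^2)dx\Big\}.$$ If $k,l>0$ satisfy $ak+\beta l=1$ and $al+\beta k=1$, then $(u_0,v_0)=(\sqrt k\,Q,\sqrt l\,Q)$ is a ground state solution of the system: it solves the system, it belongs to $\mathcal N$, and $J(u_0,v_0)=\min_{\mathcal N}J$. If moreover $a<\beta$, then $(u_0,v_0)$ also minimizes $J$ over the larger set obtained from $\mathcal N$ by replacing the condition "$u\neq0$, $v\ne0$" with $(u,v)\neq(0,0)$. -/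

import Mathlib

open MeasureTheory
open scoped FourierTransform

noncomputable section

namespace Hartree

/-- Euclidean space `ℝ³`. -/
abbrev R3 : Type := EuclideanSpace ℝ (Fin 3)

/-- Real-valued `L²(ℝ³)`. -/
abbrev L2 : Type := Lp (α := R3) ℝ 2

/-- The `L²` Fourier transform (kernel `exp (-2πi ξ·x)`) of a real-valued `L²` function. -/
def hat (u : L2) : Lp (α := R3) ℂ 2 := 𝓕 (Complex.ofRealCLM.compLp u)

/-- The Sobolev space `H^{1/2}(ℝ³)` of real-valued functions. -/
def Hhalf : Set L2 :=
  {u | Integrable (fun ξ : R3 => (1 + 2 * Real.pi * ‖ξ‖) * ‖hat u ξ‖ ^ 2)}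

/-- The squared norm `‖u‖² = ∫ (1 + 2π|ξ|) |û(ξ)|² dξ = ∫ (|(-Δ)^{1/4} u|² + u²) dx`. -/
def normSq (u : L2) : ℝ := ∫ ξ : R3, (1 + 2 * Real.pi * ‖ξ‖) * ‖hat u ξ‖ ^ 2

/-- The quadratic-form pairing `((√(-Δ) + 1) u, w) = ∫ (1 + 2π|ξ|) û(ξ) conj(ŵ(ξ)) dξ`;
for real-valued `u` and `w` the integral is real, so its real part is taken under the integral. -/
def form (u w : L2) : ℝ :=
  ∫ ξ : R3, (1 + 2 * Real.pi * ‖ξ‖) * (hat u ξ * star (hat w ξ)).re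

/-- The Hartree potential `φ_u = |x|⁻¹ ∗ u²`. -/
def phi (u : L2) (x : R3) : ℝ := ∫ y : R3, u y ^ 2 / ‖x - y‖

/-- `D u v = ∫ φ_u v² dx`. -/
def D (u v : L2) : ℝ := ∫ x : R3, phi u x * v x ^ 2

/-! ### The scalar equation `√(-Δ) u + u = φ_u u` -/

/-- `u ∈ H^{1/2}` is a weak solution of `√(-Δ) u + u = φ_u u`. -/
def IsScalarSolution (u : L2) : Prop :=
  u ∈ Hhalf ∧ ∀ w ∈ Hhalf, form u w = ∫ x : R3, phi u x * u x * w x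

/-- Energy of the scalar equation. -/
def scalarEnergy (u : L2) : ℝ := normSq u / 2 - D u u / 4

/-- Nehari manifold of the scalar equation. -/
def scalarNehari : Set L2 := {u | u ∈ Hhalf ∧ u ≠ 0 ∧ normSq u = D u u}

/-- Ground state solution of the scalar equation: a solution that minimizes the energy over the
Nehari manifold. -/
def IsScalarGroundState (u : L2) : Prop :=
  IsScalarSolution u ∧ u ∈ scalarNehari ∧ IsMinOn scalarEnergy scalarNehari u

/-! ### The system `√(-Δ) u + u = a φ_u u + β φ_v u`, `√(-Δ) v + v = a φ_v v + β φ_u v` -/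

/-- `(u, v) ∈ H^{1/2} × H^{1/2}` is a weak solution of the system. -/
def IsSystemSolution (a β : ℝ) (z : L2 × L2) : Prop :=
  z.1 ∈ Hhalf ∧ z.2 ∈ Hhalf ∧
  (∀ w ∈ Hhalf, form z.1 w =
    ∫ x : R3, (a * phi z.1 x * z.1 x + β * phi z.2 x * z.1 x) * w x) ∧
  (∀ w ∈ Hhalf, form z.2 w =
    ∫ x : R3, (a * phi z.2 x * z.2 x + β * phi z.1 x * z.2 x) * w x)

/-- The energy functional of the system. -/
def J (a β : ℝ) (z : L2 × L2) : ℝ :=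
  (normSq z.1 + normSq z.2) / 2
    - (∫ x : R3, (a * (phi z.1 x * z.1 x ^ 2) + a * (phi z.2 x * z.2 x ^ 2)
        + 2 * β * (phi z.1 x * z.2 x ^ 2))) / 4

/-- The two Nehari constraints on a pair in `H^{1/2} × H^{1/2}`. -/
def NehariConstraints (a β : ℝ) (z : L2 × L2) : Prop :=
  z.1 ∈ Hhalf ∧ z.2 ∈ Hhalf ∧
  normSq z.1 = ∫ x : R3, (a * (phi z.1 x * z.1 x ^ 2) + β * (phi z.2 x * z.1 x ^ 2)) ∧
  normSq z.2 = ∫ x : R3, (a * (phi z.2 x * z.2 x ^ 2) + β * (phi z.1 x * z.2 x ^ 2))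

/-- The Nehari manifold of the system: both components are nonzero. -/
def nehari (a β : ℝ) : Set (L2 × L2) :=
  {z | z.1 ≠ 0 ∧ z.2 ≠ 0 ∧ NehariConstraints a β z}

/-- The larger set in which only `(0, 0)` is excluded, so that one component may vanish. -/
def nehariWide (a β : ℝ) : Set (L2 × L2) :=
  {z | z ≠ (0, 0) ∧ NehariConstraints a β z}

/-- Ground state solution of the system: a solution that minimizes the energy over the Nehari
manifold. -/
def IsGroundState (a β : ℝ) (z : L2 × L2) : Prop :=
  IsSystemSolution a β z ∧ z ∈ nehari a β ∧ IsMinOn (J a β) (nehari a β) z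

end Hartree

end

/-!
Rescaling onto the scalar Nehari manifold turns minimality of `Q` into the sharp inequality
`‖Q‖² D(u, u) ≤ ‖u‖⁴`. The Coulomb kernel is a positive superposition of Gaussians, each of which
is the convolution of a Gaussian with itself, so `D(u, v)² ≤ D(u, u) D(v, v)` and hence
`‖Q‖² D(u, v) ≤ ‖u‖² ‖v‖²`. Inserted in the first Nehari constraint, this gives
`‖Q‖² ≤ a ‖u‖² + β ‖v‖²` whenever `u ≠ 0`, and symmetrically for `v`. The sum of the two,
`2 ‖Q‖² ≤ (a + β) (‖u‖² + ‖v‖²)`, is an equality for `(√k Q, √l Q)`, while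
`J(u, v) = (‖u‖² + ‖v‖²) / 4` on the constraints. If one component vanishes, the same bound follows
from the single inequality `‖Q‖² ≤ a ‖u‖²` and `a ≤ β`.
-/

open Set Module
open scoped ENNReal

namespace Hartree

section KernelEnergy

variable {X P : Type*} [MeasurableSpace X] [MeasurableSpace P] {ν : Measure X} {μ : Measure P}

/-- The energy `∬ f(x) g(y) K(x, y) dν(x) dν(y)` of two densities interacting through the
kernel `K`. -/
noncomputable def kernelEnergy (ν : Measure X) (K : X → X → ℝ≥0∞) (f g : X → ℝ≥0∞) : ℝ≥0∞ :=
  ∫⁻ x, ∫⁻ y, f x * g y * K x y ∂ν ∂ν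

lemma kernelEnergy_comm [SFinite ν] {K : X → X → ℝ≥0∞} (hK : Measurable (Function.uncurry K))
    (hsymm : ∀ x y, K x y = K y x) {f g : X → ℝ≥0∞} (hf : Measurable f) (hg : Measurable g) :
    kernelEnergy ν K f g = kernelEnergy ν K g f := by
  have hm : Measurable (Function.uncurry fun x y => f x * g y * K x y) :=
    ((hf.comp measurable_fst).mul (hg.comp measurable_snd)).mul hK
  rw [kernelEnergy, lintegral_lintegral_swap hm.aemeasurable]
  refine lintegral_congr fun y => lintegral_congr fun x => ?_
  rw [mul_comm (f x), hsymm]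

lemma measurable_lintegral_mul_right [SFinite ν] {κ : P → X → ℝ≥0∞}
    (hκ : Measurable (Function.uncurry κ)) {f : X → ℝ≥0∞} (hf : Measurable f) :
    Measurable fun p => ∫⁻ x, f x * κ p x ∂ν :=
  Measurable.lintegral_prod_right' (f := fun q : P × X => f q.2 * κ q.1 q.2)
    ((hf.comp measurable_snd).mul hκ)

lemma kernelEnergy_of_factorization [SFinite ν] [SFinite μ] {κ : P → X → ℝ≥0∞}
    (hκ : Measurable (Function.uncurry κ)) {f g : X → ℝ≥0∞} (hf : Measurable f)
    (hg : Measurable g) :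
    kernelEnergy ν (fun x y => ∫⁻ p, κ p x * κ p y ∂μ) f g =
      ∫⁻ p, (∫⁻ x, f x * κ p x ∂ν) * (∫⁻ y, g y * κ p y ∂ν) ∂μ := by
  have hκ_left (p : P) : Measurable (κ p) := hκ.of_uncurry_left
  have hκ_right (x : X) : Measurable fun p => κ p x := hκ.of_uncurry_right
  calc kernelEnergy ν (fun x y => ∫⁻ p, κ p x * κ p y ∂μ) f g
      = ∫⁻ x, ∫⁻ y, ∫⁻ p, f x * κ p x * (g y * κ p y) ∂μ ∂ν ∂ν := by
        refine lintegral_congr fun x => lintegral_congr fun y => ?_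
        rw [← lintegral_const_mul _ ((hκ_right x).fun_mul (hκ_right y))]
        exact lintegral_congr fun p => by ring
    _ = ∫⁻ x, ∫⁻ p, ∫⁻ y, f x * κ p x * (g y * κ p y) ∂ν ∂μ ∂ν := by
        refine lintegral_congr fun x => lintegral_lintegral_swap (Measurable.aemeasurable ?_)
        exact (measurable_const.mul ((hκ_right x).comp measurable_snd)).mul
          ((hg.comp measurable_fst).mul (hκ.comp measurable_swap))
    _ = ∫⁻ x, ∫⁻ p, f x * κ p x * ∫⁻ y, g y * κ p y ∂ν ∂μ ∂ν :=
        lintegral_congr fun x => lintegral_congr fun p =>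
          lintegral_const_mul _ (hg.fun_mul (hκ_left p))
    _ = ∫⁻ p, ∫⁻ x, f x * κ p x * ∫⁻ y, g y * κ p y ∂ν ∂ν ∂μ := by
        refine lintegral_lintegral_swap (Measurable.aemeasurable ?_)
        exact ((hf.comp measurable_fst).mul (hκ.comp measurable_swap)).mul
          ((measurable_lintegral_mul_right hκ hg).comp measurable_snd)
    _ = ∫⁻ p, (∫⁻ x, f x * κ p x ∂ν) * (∫⁻ y, g y * κ p y ∂ν) ∂μ :=
        lintegral_congr fun p => lintegral_mul_const _ (hf.fun_mul (hκ_left p))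

lemma sq_lintegral_mul_le {f g : P → ℝ≥0∞} (hf : AEMeasurable f μ) (hg : AEMeasurable g μ) :
    (∫⁻ p, f p * g p ∂μ) ^ 2 ≤ (∫⁻ p, f p * f p ∂μ) * ∫⁻ p, g p * g p ∂μ := by
  have hHolder := ENNReal.lintegral_mul_le_Lp_mul_Lq μ Real.HolderConjugate.two_two hf hg
  simp only [ENNReal.rpow_two, sq, Pi.mul_apply, one_div] at hHolder
  calc (∫⁻ p, f p * g p ∂μ) ^ 2
      ≤ ((∫⁻ p, f p * f p ∂μ) ^ (2⁻¹ : ℝ) * (∫⁻ p, g p * g p ∂μ) ^ (2⁻¹ : ℝ)) ^ 2 := by gcongr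
    _ = (∫⁻ p, f p * f p ∂μ) * ∫⁻ p, g p * g p ∂μ := by
      rw [mul_pow, ← ENNReal.rpow_two, ← ENNReal.rpow_two, ENNReal.rpow_inv_rpow two_ne_zero,
        ENNReal.rpow_inv_rpow two_ne_zero]

lemma sq_kernelEnergy_le_of_factorization [SFinite ν] [SFinite μ] {κ : P → X → ℝ≥0∞}
    (hκ : Measurable (Function.uncurry κ)) {f g : X → ℝ≥0∞} (hf : Measurable f)
    (hg : Measurable g) :
    kernelEnergy ν (fun x y => ∫⁻ p, κ p x * κ p y ∂μ) f g ^ 2 ≤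
      kernelEnergy ν (fun x y => ∫⁻ p, κ p x * κ p y ∂μ) f f *
        kernelEnergy ν (fun x y => ∫⁻ p, κ p x * κ p y ∂μ) g g := by
  rw [kernelEnergy_of_factorization hκ hf hg, kernelEnergy_of_factorization hκ hf hf,
    kernelEnergy_of_factorization hκ hg hg]
  exact sq_lintegral_mul_le (measurable_lintegral_mul_right hκ hf).aemeasurable
    (measurable_lintegral_mul_right hκ hg).aemeasurable

end KernelEnergy

lemma ae_lintegral_mul_comp_sub_lt_top {G : Type*} [AddGroup G] [MeasurableSpace G]
    [MeasurableAdd G] [MeasurableSub₂ G] {μ : Measure G} [SFinite μ] [μ.IsAddRightInvariant]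
    {f k : G → ℝ≥0∞} (hf : Measurable f) (hk : Measurable k) (hf_fin : ∫⁻ y, f y ∂μ ≠ ∞)
    (hk_fin : ∫⁻ y, k y ∂μ ≠ ∞) : ∀ᵐ x ∂μ, ∫⁻ y, f y * k (x - y) ∂μ < ∞ := by
  have hm : Measurable (Function.uncurry fun x y => f y * k (x - y)) :=
    (hf.comp measurable_snd).mul (hk.comp measurable_sub)
  refine ae_lt_top hm.lintegral_prod_right' ?_
  have hTonelli : ∫⁻ x, ∫⁻ y, f y * k (x - y) ∂μ ∂μ = (∫⁻ y, f y ∂μ) * ∫⁻ x, k x ∂μ := by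
    rw [lintegral_lintegral_swap hm.aemeasurable, ← lintegral_mul_const _ hf]
    refine lintegral_congr fun y => ?_
    rw [lintegral_const_mul _ (by fun_prop), lintegral_sub_right_eq_self k y]
  exact hTonelli ▸ ENNReal.mul_ne_top hf_fin hk_fin

section Riesz

variable {E : Type*} [NormedAddCommGroup E]

/-- The Riesz kernel `|x - y|⁻ˢ`; the Coulomb kernel on `ℝ³` is the case `s = 1`. On the diagonal
its value is `0` for `s ≠ 0`. -/
noncomputable def rieszKernel (s : ℝ) (x y : E) : ℝ≥0∞ := ENNReal.ofReal (‖x - y‖ ^ (-s))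

lemma rieszKernel_comm (s : ℝ) (x y : E) : rieszKernel s x y = rieszKernel s y x := by
  rw [rieszKernel, norm_sub_rev, rieszKernel]

lemma rpow_neg_norm_le_indicator_add_one {s : ℝ} (hs : 0 ≤ s) (z : E) :
    ENNReal.ofReal (‖z‖ ^ (-s)) ≤
      (Metric.ball 0 1).indicator (fun z => ENNReal.ofReal (‖z‖ ^ (-s))) z + 1 := by
  by_cases hz : z ∈ Metric.ball 0 1
  · rw [indicator_of_mem hz]
    exact le_self_add
  · have hz_far : 1 ≤ ‖z‖ := by simpa using hz
    rw [indicator_of_notMem hz, zero_add, ENNReal.ofReal_le_one]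
    exact Real.rpow_le_one_of_one_le_of_nonpos hz_far (neg_nonpos.2 hs)

/-- The Gaussian `exp (-t |x - z|²)`, where `p = (t, z)`. -/
noncomputable def gaussian (p : ℝ × E) (x : E) : ℝ≥0∞ :=
  ENNReal.ofReal (Real.exp (-p.1 * ‖x - p.2‖ ^ 2))

lemma gaussian_mul_gaussian [InnerProductSpace ℝ E] (t : ℝ) (x y z : E) :
    gaussian (t, z) x * gaussian (t, z) y = ENNReal.ofReal (Real.exp (-(t / 2) * ‖x - y‖ ^ 2) *
      Real.exp (-(2 * t) * ‖z - midpoint ℝ x y‖ ^ 2)) := by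
  have hApollonius : ‖x - z‖ ^ 2 + ‖y - z‖ ^ 2 =
      2 * ‖z - midpoint ℝ x y‖ ^ 2 + ‖x - y‖ ^ 2 / 2 := by
    have h := EuclideanGeometry.dist_sq_add_dist_sq_eq_two_mul_dist_midpoint_sq_add_half_dist_sq
      z x y
    simp only [dist_eq_norm, norm_sub_rev z x, norm_sub_rev z y] at h
    linear_combination h
  rw [gaussian, gaussian, ← ENNReal.ofReal_mul (Real.exp_nonneg _), ← Real.exp_add,
    ← Real.exp_add]
  congr 2
  linear_combination -t * hApollonius

variable [MeasurableSpace E] [BorelSpace E]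

lemma measurable_rieszKernel [SecondCountableTopology E] (s : ℝ) :
    Measurable (Function.uncurry (rieszKernel (E := E) s)) := by
  unfold rieszKernel Function.uncurry
  fun_prop

lemma measurable_gaussian [SecondCountableTopology E] :
    Measurable (Function.uncurry (gaussian (E := E))) := by
  unfold gaussian Function.uncurry
  fun_prop

variable [InnerProductSpace ℝ E] [FiniteDimensional ℝ E]

lemma integrableOn_ball_norm_rpow_neg [Nontrivial E] {s : ℝ} (hs : s < finrank ℝ E) :
    IntegrableOn (fun x : E => ‖x‖ ^ (-s)) (Metric.ball 0 1) := by
  refine integrableOn_ball_of_norm_le_rpow (C := 1) finrank_pos hs (ae_of_all _ fun x => ?_)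
    (Measurable.aestronglyMeasurable (by fun_prop))
  rw [one_mul, Real.norm_of_nonneg (by positivity)]

/-- Near the diagonal the kernel is integrable, away from it the kernel is at most `1`. -/
lemma ae_lintegral_mul_rieszKernel_lt_top {s : ℝ} (hs : 0 ≤ s) (hsd : s < finrank ℝ E)
    {f : E → ℝ≥0∞} (hf : Measurable f) (hf_fin : ∫⁻ y, f y ≠ ∞) :
    ∀ᵐ x, ∫⁻ y, f y * rieszKernel s x y < ∞ := by
  have : Nontrivial E := nontrivial_of_finrank_pos (R := ℝ) (by exact_mod_cast hs.trans_lt hsd)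
  set k : E → ℝ≥0∞ := (Metric.ball 0 1).indicator fun z => ENNReal.ofReal (‖z‖ ^ (-s))
  have hk : Measurable k := Measurable.indicator (by fun_prop) measurableSet_ball
  have hk_fin : ∫⁻ z, k z ≠ ∞ := by
    rw [lintegral_indicator measurableSet_ball]
    exact (integrableOn_ball_norm_rpow_neg hsd).lintegral_lt_top.ne
  filter_upwards [ae_lintegral_mul_comp_sub_lt_top hf hk hf_fin hk_fin] with x hx
  calc ∫⁻ y, f y * rieszKernel s x y
      ≤ ∫⁻ y, (f y * k (x - y) + f y) := by
        refine lintegral_mono fun y => ?_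
        calc f y * rieszKernel s x y ≤ f y * (k (x - y) + 1) :=
              mul_le_mul_right (rpow_neg_norm_le_indicator_add_one hs (x - y)) _
          _ = f y * k (x - y) + f y := by ring
    _ = (∫⁻ y, f y * k (x - y)) + ∫⁻ y, f y := lintegral_add_right _ hf
    _ < ∞ := ENNReal.add_lt_top.2 ⟨hx, hf_fin.lt_top⟩

lemma integrable_exp_neg_mul_sq_norm {b : ℝ} (hb : 0 < b) :
    Integrable fun z : E => Real.exp (-b * ‖z‖ ^ 2) := by
  refine .of_integral_ne_zero ?_
  rw [GaussianFourier.integral_rexp_neg_mul_sq_norm hb]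
  positivity

lemma lintegral_gaussian_mul_gaussian {t : ℝ} (ht : 0 < t) (x y : E) :
    ∫⁻ z, gaussian (t, z) x * gaussian (t, z) y = ENNReal.ofReal
      (Real.exp (-(t / 2) * ‖x - y‖ ^ 2) * (Real.pi / (2 * t)) ^ (finrank ℝ E / 2 : ℝ)) := by
  have h2t : 0 < 2 * t := by positivity
  simp_rw [gaussian_mul_gaussian]
  rw [← ofReal_integral_eq_lintegral_ofReal
      (((integrable_exp_neg_mul_sq_norm h2t).comp_sub_right _).const_mul _)
      (ae_of_all _ fun z => by positivity),
    integral_const_mul, integral_sub_right_eq_self (fun z : E => Real.exp (-(2 * t) * ‖z‖ ^ 2)),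
    GaussianFourier.integral_rexp_neg_mul_sq_norm h2t]

/-- The density in `t` for which the Gaussians of width parameter `t` superpose to the Riesz kernel
of exponent `s` in dimension `d`. The powers of `t` and `2` come from
`∫₀^∞ t^(s/2 - 1) exp (-t r² / 2) dt = 2^(s/2) Γ(s/2) r⁻ˢ`; the last factor normalizes
`∫ gaussian (t, z) x * gaussian (t, z) y dz` to `exp (-t |x - y|² / 2)`. -/
noncomputable def rieszScaleDensity (d : ℕ) (s t : ℝ) : ℝ :=
  t ^ (s / 2 - 1) / (2 ^ (s / 2) * Real.Gamma (s / 2)) * (Real.pi / (2 * t)) ^ (-(d / 2 : ℝ))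

/-- The measure on scales and centres `(t, z)` that factors the Riesz kernel through Gaussians. -/
noncomputable def rieszScaleMeasure (E : Type*) [NormedAddCommGroup E] [MeasurableSpace E]
    [BorelSpace E] [InnerProductSpace ℝ E] [FiniteDimensional ℝ E] (s : ℝ) : Measure (ℝ × E) :=
  ((volume.restrict (Ioi (0 : ℝ))).withDensity
    fun t => ENNReal.ofReal (rieszScaleDensity (finrank ℝ E) s t)).prod volume

lemma lintegral_rpow_mul_exp_neg_mul_Ioi {a r : ℝ} (ha : 0 < a) (hr : 0 < r) :
    ∫⁻ t in Ioi 0, ENNReal.ofReal (t ^ (a - 1) * Real.exp (-(r * t))) =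
      ENNReal.ofReal ((1 / r) ^ a * Real.Gamma a) := by
  have hpos : 0 < (1 / r) ^ a * Real.Gamma a := by positivity
  have hval := Real.integral_rpow_mul_exp_neg_mul_Ioi ha hr
  rw [← hval, ofReal_integral_eq_lintegral_ofReal (.of_integral_ne_zero (hval ▸ hpos.ne'))]
  filter_upwards [ae_restrict_mem measurableSet_Ioi] with t ht
  have : 0 < t := ht
  positivity

lemma rieszScaleDensity_mul_lintegral_gaussian {s t : ℝ} (hs : 0 < s) (ht : 0 < t) (x y : E) :
    ENNReal.ofReal (rieszScaleDensity (finrank ℝ E) s t) *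
        ∫⁻ z, gaussian (t, z) x * gaussian (t, z) y =
      ENNReal.ofReal (2 ^ (s / 2) * Real.Gamma (s / 2))⁻¹ *
        ENNReal.ofReal (t ^ (s / 2 - 1) * Real.exp (-(‖x - y‖ ^ 2 / 2 * t))) := by
  have hb : 0 < Real.pi / (2 * t) := by positivity
  rw [lintegral_gaussian_mul_gaussian ht, rieszScaleDensity, ← ENNReal.ofReal_mul (by positivity),
    ← ENNReal.ofReal_mul (by positivity), Real.rpow_neg hb.le]
  congr 1
  field_simp

lemma rieszKernel_eq_lintegral_gaussian {s : ℝ} (hs : 0 < s) {x y : E} (hxy : x ≠ y) :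
    rieszKernel s x y = ∫⁻ p, gaussian p x * gaussian p y ∂rieszScaleMeasure E s := by
  have hr : 0 < ‖x - y‖ := norm_sub_pos_iff.2 hxy
  have hm : Measurable fun p => gaussian p x * gaussian p y :=
    measurable_gaussian.of_uncurry_right.mul measurable_gaussian.of_uncurry_right
  have hρ : Measurable (rieszScaleDensity (finrank ℝ E) s) := by
    unfold rieszScaleDensity
    fun_prop
  symm
  calc ∫⁻ p, gaussian p x * gaussian p y ∂rieszScaleMeasure E s
      = ∫⁻ t in Ioi 0, ENNReal.ofReal (rieszScaleDensity (finrank ℝ E) s t) *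
          ∫⁻ z, gaussian (t, z) x * gaussian (t, z) y := by
        rw [rieszScaleMeasure, lintegral_prod _ hm.aemeasurable,
          lintegral_withDensity_eq_lintegral_mul _ hρ.ennreal_ofReal hm.lintegral_prod_right']
        rfl
    _ = ENNReal.ofReal (2 ^ (s / 2) * Real.Gamma (s / 2))⁻¹ * ∫⁻ t in Ioi 0,
          ENNReal.ofReal (t ^ (s / 2 - 1) * Real.exp (-(‖x - y‖ ^ 2 / 2 * t))) := by
        rw [setLIntegral_congr_fun measurableSet_Ioi fun t ht =>
            rieszScaleDensity_mul_lintegral_gaussian hs ht x y,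
          lintegral_const_mul' _ _ ENNReal.ofReal_ne_top]
    _ = rieszKernel s x y := by
        have hpow : (‖x - y‖ ^ 2) ^ (s / 2) = ‖x - y‖ ^ s := by
          rw [← Real.rpow_natCast_mul hr.le, Nat.cast_ofNat, mul_div_cancel₀ s two_ne_zero]
        rw [lintegral_rpow_mul_exp_neg_mul_Ioi (by positivity) (by positivity),
          ← ENNReal.ofReal_mul (by positivity), one_div_div,
          Real.div_rpow zero_le_two (by positivity), hpow, rieszKernel, Real.rpow_neg hr.le]
        congr 1
        field_simp

instance (s : ℝ) : SFinite (rieszScaleMeasure E s) := by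
  unfold rieszScaleMeasure
  infer_instance

variable [Nontrivial E]

lemma kernelEnergy_rieszKernel_eq {s : ℝ} (hs : 0 < s) (f g : E → ℝ≥0∞) :
    kernelEnergy volume (rieszKernel s) f g = kernelEnergy volume
      (fun x y => ∫⁻ p, gaussian p x * gaussian p y ∂rieszScaleMeasure E s) f g := by
  refine lintegral_congr fun x => lintegral_congr_ae ?_
  have hdiag : ∀ᵐ y : E, y ≠ x := by simp [ae_iff]
  filter_upwards [hdiag] with y hy
  rw [rieszKernel_eq_lintegral_gaussian hs hy.symm]

lemma sq_kernelEnergy_rieszKernel_le {s : ℝ} (hs : 0 < s) {f g : E → ℝ≥0∞} (hf : Measurable f)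
    (hg : Measurable g) :
    kernelEnergy volume (rieszKernel s) f g ^ 2 ≤
      kernelEnergy volume (rieszKernel s) f f * kernelEnergy volume (rieszKernel s) g g := by
  simp only [kernelEnergy_rieszKernel_eq hs]
  exact sq_kernelEnergy_le_of_factorization measurable_gaussian hf hg

end Riesz

section FourierSide

lemma hat_smul (c : ℝ) (u : L2) : hat (c • u) = (c : ℂ) • hat u := by
  have hlinear : Complex.ofRealCLM.compLp (c • u) = (c : ℂ) • Complex.ofRealCLM.compLp u := by
    rw [Complex.coe_smul]
    exact map_smul (Complex.ofRealCLM.compLpₗ 2 volume) c u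
  rw [hat, hlinear, FourierTransform.fourier_smul, ← hat]

lemma hat_smul_ae (c : ℝ) (u : L2) : ∀ᵐ ξ, hat (c • u) ξ = c * hat u ξ := by
  rw [hat_smul]
  exact Lp.coeFn_smul (c : ℂ) (hat u)

lemma norm_hat (u : L2) : ‖hat u‖ = ‖u‖ := by
  rw [hat, Lp.norm_fourier_eq, Lp.norm_def, Lp.norm_def]
  congr 1
  refine eLpNorm_congr_norm_ae ?_
  filter_upwards [Complex.ofRealCLM.coeFn_compLp u] with x hx
  rw [hx, Complex.ofRealCLM_apply, Complex.norm_real]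

lemma normSq_nonneg (u : L2) : 0 ≤ normSq u :=
  integral_nonneg fun ξ => by positivity

lemma normSq_pos {u : L2} (hu : u ∈ Hhalf) (hu_ne : u ≠ 0) : 0 < normSq u := by
  refine (normSq_nonneg u).lt_of_ne fun h => hu_ne ?_
  have hhat : hat u = 0 := by
    rw [Lp.eq_zero_iff_ae_eq_zero]
    filter_upwards [(integral_eq_zero_iff_of_nonneg (fun ξ => by positivity) hu).1 h.symm]
      with ξ hξ
    have hweight : 0 < 1 + 2 * Real.pi * ‖ξ‖ := by positivity
    simpa [hweight.ne'] using hξ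
  rw [← norm_eq_zero, ← norm_hat, hhat, norm_zero]

lemma weighted_hat_smul_ae (c : ℝ) (u : L2) :
    (fun ξ : R3 => (1 + 2 * Real.pi * ‖ξ‖) * ‖hat (c • u) ξ‖ ^ 2) =ᵐ[volume]
      fun ξ => c ^ 2 * ((1 + 2 * Real.pi * ‖ξ‖) * ‖hat u ξ‖ ^ 2) := by
  filter_upwards [hat_smul_ae c u] with ξ hξ
  rw [hξ, norm_mul, mul_pow, Complex.norm_real, Real.norm_eq_abs, sq_abs]
  ring

lemma smul_mem_Hhalf (c : ℝ) {u : L2} (hu : u ∈ Hhalf) : c • u ∈ Hhalf :=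
  (Integrable.const_mul hu (c ^ 2)).congr (weighted_hat_smul_ae c u).symm

lemma normSq_smul (c : ℝ) (u : L2) : normSq (c • u) = c ^ 2 * normSq u := by
  rw [normSq, integral_congr_ae (weighted_hat_smul_ae c u), integral_const_mul, ← normSq]

lemma normSq_zero : normSq 0 = 0 := by
  simpa using normSq_smul 0 0

lemma form_smul_left (c : ℝ) (u w : L2) : form (c • u) w = c * form u w := by
  rw [form, form, ← integral_const_mul]
  refine integral_congr_ae ?_
  filter_upwards [hat_smul_ae c u] with ξ hξ
  rw [hξ, mul_assoc (c : ℂ), Complex.re_ofReal_mul]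
  ring

end FourierSide

section Coulomb

/-- The density `u²` with values in `[0, ∞]`. -/
noncomputable def density (u : L2) (x : R3) : ℝ≥0∞ := ENNReal.ofReal (u x ^ 2)

/-- The Coulomb energy `∬ u(x)² v(y)² / |x - y| dx dy` as an element of `[0, ∞]`. Its real value is
`D u v`, which is the junk value `0` when the energy is infinite. -/
noncomputable def coulombEnergy (u v : L2) : ℝ≥0∞ :=
  kernelEnergy volume (rieszKernel 1) (density u) (density v)

lemma measurable_coeFn (u : L2) : Measurable u := (Lp.stronglyMeasurable u).measurable

lemma measurable_density (u : L2) : Measurable (density u) :=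
  ((measurable_coeFn u).pow_const 2).ennreal_ofReal

lemma lintegral_density_ne_top (u : L2) : ∫⁻ x, density u x ≠ ∞ :=
  (Lp.memLp u).integrable_sq.lintegral_lt_top.ne

lemma coulombEnergy_comm (u v : L2) : coulombEnergy u v = coulombEnergy v u :=
  kernelEnergy_comm (measurable_rieszKernel 1) (rieszKernel_comm 1) (measurable_density u)
    (measurable_density v)

lemma sq_coulombEnergy_le (u v : L2) :
    coulombEnergy u v ^ 2 ≤ coulombEnergy u u * coulombEnergy v v :=
  sq_kernelEnergy_rieszKernel_le one_pos (measurable_density u) (measurable_density v)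

lemma phi_nonneg (u : L2) (x : R3) : 0 ≤ phi u x :=
  integral_nonneg fun y => by positivity

lemma measurable_phi (u : L2) : Measurable (phi u) := by
  have hu := measurable_coeFn u
  have hm : StronglyMeasurable fun q : R3 × R3 => u q.2 ^ 2 / ‖q.1 - q.2‖ :=
    Measurable.stronglyMeasurable (by fun_prop)
  exact hm.integral_prod_right'.measurable

lemma ofReal_phi_ae (u : L2) :
    ∀ᵐ x : R3, ENNReal.ofReal (phi u x) = ∫⁻ y, density u y * rieszKernel 1 x y := by
  have hu := measurable_coeFn u
  have hintegrand (x y : R3) :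
      ENNReal.ofReal (u y ^ 2 / ‖x - y‖) = density u y * rieszKernel 1 x y := by
    rw [density, rieszKernel, ← ENNReal.ofReal_mul (by positivity), Real.rpow_neg_one,
      div_eq_mul_inv]
  filter_upwards [ae_lintegral_mul_rieszKernel_lt_top zero_le_one (by simp)
    (measurable_density u) (lintegral_density_ne_top u)] with x hx
  rw [phi, integral_eq_lintegral_of_nonneg_ae (ae_of_all _ fun y => by positivity)
    (Measurable.aestronglyMeasurable (by fun_prop))]
  simp only [hintegrand]
  exact ENNReal.ofReal_toReal hx.ne

lemma phi_mul_sq_nonneg (u v : L2) (x : R3) : 0 ≤ phi u x * v x ^ 2 :=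
  mul_nonneg (phi_nonneg u x) (sq_nonneg _)

lemma measurable_phi_mul_sq (u v : L2) : Measurable fun x => phi u x * v x ^ 2 :=
  (measurable_phi u).mul ((measurable_coeFn v).pow_const 2)

lemma lintegral_phi_mul_sq (u v : L2) :
    ∫⁻ x, ENNReal.ofReal (phi u x * v x ^ 2) = coulombEnergy u v := by
  rw [coulombEnergy_comm]
  refine lintegral_congr_ae ?_
  filter_upwards [ofReal_phi_ae u] with x hx
  rw [ENNReal.ofReal_mul (phi_nonneg u x), hx, mul_comm, ← density, ← lintegral_const_mul _
    ((measurable_density u).fun_mul (measurable_rieszKernel 1).of_uncurry_left)]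
  simp only [mul_assoc]

lemma D_eq_toReal_coulombEnergy (u v : L2) : D u v = (coulombEnergy u v).toReal := by
  rw [D, integral_eq_lintegral_of_nonneg_ae (ae_of_all _ (phi_mul_sq_nonneg u v))
    (measurable_phi_mul_sq u v).aestronglyMeasurable, lintegral_phi_mul_sq]

lemma integrable_phi_mul_sq_iff (u v : L2) :
    Integrable (fun x => phi u x * v x ^ 2) ↔ coulombEnergy u v < ∞ := by
  rw [← lintegral_phi_mul_sq,
    ← hasFiniteIntegral_iff_ofReal (ae_of_all _ (phi_mul_sq_nonneg u v))]
  exact and_iff_right (measurable_phi_mul_sq u v).aestronglyMeasurable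

lemma D_nonneg (u v : L2) : 0 ≤ D u v := integral_nonneg (phi_mul_sq_nonneg u v)

lemma D_comm (u v : L2) : D u v = D v u := by
  rw [D_eq_toReal_coulombEnergy, D_eq_toReal_coulombEnergy, coulombEnergy_comm]

lemma integrable_phi_mul_sq_of_self {u v : L2} (hu : Integrable fun x => phi u x * u x ^ 2)
    (hv : Integrable fun x => phi v x * v x ^ 2) : Integrable fun x => phi u x * v x ^ 2 := by
  rw [integrable_phi_mul_sq_iff] at hu hv ⊢
  exact (ENNReal.pow_lt_top_iff.1 ((sq_coulombEnergy_le u v).trans_lt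
    (ENNReal.mul_lt_top hu hv))).resolve_right two_ne_zero

lemma D_sq_le {u v : L2} (hu : Integrable fun x => phi u x * u x ^ 2)
    (hv : Integrable fun x => phi v x * v x ^ 2) : D u v ^ 2 ≤ D u u * D v v := by
  rw [integrable_phi_mul_sq_iff] at hu hv
  simp only [D_eq_toReal_coulombEnergy, ← ENNReal.toReal_pow, ← ENNReal.toReal_mul]
  exact ENNReal.toReal_mono (ENNReal.mul_ne_top hu.ne hv.ne) (sq_coulombEnergy_le u v)

lemma phi_smul (c : ℝ) (u : L2) (x : R3) : phi (c • u) x = c ^ 2 * phi u x := by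
  rw [phi, phi, ← integral_const_mul]
  refine integral_congr_ae ?_
  filter_upwards [Lp.coeFn_smul c u] with y hy
  rw [hy, Pi.smul_apply, smul_eq_mul]
  ring

lemma phi_zero (x : R3) : phi 0 x = 0 := by
  simpa using phi_smul 0 0 x

lemma D_smul_smul (c d : ℝ) (u v : L2) : D (c • u) (d • v) = c ^ 2 * d ^ 2 * D u v := by
  rw [D, D, ← integral_const_mul]
  refine integral_congr_ae ?_
  filter_upwards [Lp.coeFn_smul d v] with y hy
  rw [hy, Pi.smul_apply, smul_eq_mul, phi_smul]
  ring

end Coulomb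

section ScalarGroundState

variable {Q u v : L2}

lemma smul_mem_scalarNehari (hu : u ∈ Hhalf) (hu_ne : u ≠ 0) (hD : 0 < D u u) :
    √(normSq u / D u u) • u ∈ scalarNehari := by
  have hratio : 0 < normSq u / D u u := div_pos (normSq_pos hu hu_ne) hD
  refine ⟨smul_mem_Hhalf _ hu, smul_ne_zero (Real.sqrt_pos.2 hratio).ne' hu_ne, ?_⟩
  rw [normSq_smul, D_smul_smul, Real.sq_sqrt hratio.le]
  field_simp

lemma scalarEnergy_of_mem_scalarNehari (hu : u ∈ scalarNehari) :
    scalarEnergy u = normSq u / 4 := by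
  rw [scalarEnergy, ← hu.2.2]
  ring

lemma normSq_mul_D_self_le (hQ : Q ∈ scalarNehari) (hmin : IsMinOn scalarEnergy scalarNehari Q)
    (hu : u ∈ Hhalf) : normSq Q * D u u ≤ normSq u ^ 2 := by
  rcases (D_nonneg u u).eq_or_lt with hD | hD
  · rw [← hD, mul_zero]
    positivity
  have hu_ne : u ≠ 0 := by
    rintro rfl
    simp [D, phi_zero] at hD
  have hmem := smul_mem_scalarNehari hu hu_ne hD
  have henergy : scalarEnergy Q ≤ scalarEnergy (√(normSq u / D u u) • u) := hmin hmem
  rw [scalarEnergy_of_mem_scalarNehari hQ, scalarEnergy_of_mem_scalarNehari hmem, normSq_smul,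
    Real.sq_sqrt (div_nonneg (normSq_nonneg u) hD.le)] at henergy
  calc normSq Q * D u u ≤ normSq u / D u u * normSq u * D u u := by
        gcongr
        linarith
    _ = normSq u ^ 2 := by field_simp

lemma normSq_mul_D_le (hQ : Q ∈ scalarNehari) (hmin : IsMinOn scalarEnergy scalarNehari Q)
    (hu : u ∈ Hhalf) (hv : v ∈ Hhalf) (hu_int : Integrable fun x => phi u x * u x ^ 2)
    (hv_int : Integrable fun x => phi v x * v x ^ 2) :
    normSq Q * D u v ≤ normSq u * normSq v := by
  have hnormSq := mul_nonneg (normSq_nonneg u) (normSq_nonneg v)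
  refine le_of_sq_le_sq ?_ hnormSq
  calc (normSq Q * D u v) ^ 2 = normSq Q ^ 2 * D u v ^ 2 := by ring
    _ ≤ normSq Q ^ 2 * (D u u * D v v) := by
      gcongr
      exact D_sq_le hu_int hv_int
    _ = (normSq Q * D u u) * (normSq Q * D v v) := by ring
    _ ≤ normSq u ^ 2 * normSq v ^ 2 :=
      mul_le_mul (normSq_mul_D_self_le hQ hmin hu) (normSq_mul_D_self_le hQ hmin hv)
        (mul_nonneg (normSq_nonneg Q) (D_nonneg v v)) (sq_nonneg _)
    _ = (normSq u * normSq v) ^ 2 := by ring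

end ScalarGroundState

section NehariConstraints

variable {a β : ℝ} {Q u v : L2}

namespace NehariConstraints

lemma swap (h : NehariConstraints a β (u, v)) : NehariConstraints a β (v, u) :=
  ⟨h.2.1, h.1, h.2.2.2, h.2.2.1⟩

/-- For `u ≠ 0` the constraint equates an integral with `‖u‖² ≠ 0`, so the integrand, a sum of
nonnegative terms, is integrable. -/
lemma integrable_phi_fst (h : NehariConstraints a β (u, v)) (ha : 0 < a) (hβ : 0 ≤ β) :
    Integrable fun x => phi u x * u x ^ 2 := by
  rcases eq_or_ne u 0 with rfl | hu
  · simp [phi_zero]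
  have hsum : Integrable fun x => a * (phi u x * u x ^ 2) + β * (phi v x * u x ^ 2) := by
    refine .of_integral_ne_zero ?_
    rw [← h.2.2.1]
    exact (normSq_pos h.1 hu).ne'
  have hterm : Integrable fun x => a * (phi u x * u x ^ 2) := by
    refine hsum.mono' ((measurable_phi_mul_sq u u).const_mul a).aestronglyMeasurable
      (ae_of_all _ fun x => ?_)
    rw [Real.norm_of_nonneg (mul_nonneg ha.le (phi_mul_sq_nonneg u u x))]
    exact le_add_of_nonneg_right (mul_nonneg hβ (phi_mul_sq_nonneg v u x))
  exact (integrable_const_mul_iff ha.ne'.isUnit _).1 hterm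

lemma integrable_phi_snd (h : NehariConstraints a β (u, v)) (ha : 0 < a) (hβ : 0 ≤ β) :
    Integrable fun x => phi v x * v x ^ 2 :=
  h.swap.integrable_phi_fst ha hβ

lemma normSq_fst_eq (h : NehariConstraints a β (u, v)) (ha : 0 < a) (hβ : 0 ≤ β) :
    normSq u = a * D u u + β * D u v := by
  have huu := h.integrable_phi_fst ha hβ
  have hvu := integrable_phi_mul_sq_of_self (h.integrable_phi_snd ha hβ) huu
  rw [h.2.2.1, integral_add (huu.const_mul a) (hvu.const_mul β), integral_const_mul,
    integral_const_mul, ← D, ← D, D_comm v u]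

lemma J_eq (h : NehariConstraints a β (u, v)) (ha : 0 < a) (hβ : 0 ≤ β) :
    J a β (u, v) = (normSq u + normSq v) / 4 := by
  have huu := h.integrable_phi_fst ha hβ
  have hvv := h.integrable_phi_snd ha hβ
  have huv := integrable_phi_mul_sq_of_self huu hvv
  have hJ : J a β (u, v) =
      (normSq u + normSq v) / 2 - (a * D u u + a * D v v + 2 * β * D u v) / 4 := by
    rw [J, integral_add ((huu.const_mul a).fun_add (hvv.const_mul a)) (huv.const_mul (2 * β)),
      integral_add (huu.const_mul a) (hvv.const_mul a), integral_const_mul, integral_const_mul,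
      integral_const_mul, ← D, ← D, ← D]
  have hv := h.swap.normSq_fst_eq ha hβ
  rw [D_comm v u] at hv
  linear_combination hJ + (h.normSq_fst_eq ha hβ + hv) / 4

lemma normSq_le_of_fst_ne_zero (h : NehariConstraints a β (u, v)) (ha : 0 < a) (hβ : 0 ≤ β)
    (hQ : Q ∈ scalarNehari) (hmin : IsMinOn scalarEnergy scalarNehari Q) (hu : u ≠ 0) :
    normSq Q ≤ a * normSq u + β * normSq v := by
  have huu := normSq_mul_D_self_le hQ hmin h.1
  have huv := normSq_mul_D_le hQ hmin h.1 h.2.1 (h.integrable_phi_fst ha hβ)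
    (h.integrable_phi_snd ha hβ)
  refine le_of_mul_le_mul_left ?_ (normSq_pos h.1 hu)
  calc normSq u * normSq Q = a * (normSq Q * D u u) + β * (normSq Q * D u v) := by
        rw [h.normSq_fst_eq ha hβ]
        ring
    _ ≤ a * normSq u ^ 2 + β * (normSq u * normSq v) := by gcongr
    _ = normSq u * (a * normSq u + β * normSq v) := by ring

end NehariConstraints

lemma two_mul_normSq_le_of_mem_nehari (ha : 0 < a) (hβ : 0 ≤ β) (hQ : Q ∈ scalarNehari)
    (hmin : IsMinOn scalarEnergy scalarNehari Q) (h : (u, v) ∈ nehari a β) :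
    2 * normSq Q ≤ (a + β) * (normSq u + normSq v) := by
  obtain ⟨hu, hv, hc⟩ := h
  have hQu := hc.normSq_le_of_fst_ne_zero ha hβ hQ hmin hu
  have hQv := hc.swap.normSq_le_of_fst_ne_zero ha hβ hQ hmin hv
  linarith

lemma two_mul_normSq_le_of_snd_eq_zero (ha : 0 < a) (hle : a ≤ β) (hQ : Q ∈ scalarNehari)
    (hmin : IsMinOn scalarEnergy scalarNehari Q) (h : NehariConstraints a β (u, 0))
    (hu : u ≠ 0) : 2 * normSq Q ≤ (a + β) * normSq u := by
  have hQu := h.normSq_le_of_fst_ne_zero ha (ha.le.trans hle) hQ hmin hu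
  rw [normSq_zero, mul_zero, add_zero] at hQu
  calc 2 * normSq Q ≤ (a + a) * normSq u := by linarith
    _ ≤ (a + β) * normSq u := mul_le_mul_of_nonneg_right (by gcongr) (normSq_nonneg u)

lemma two_mul_normSq_le_of_mem_nehariWide (ha : 0 < a) (hle : a ≤ β) (hQ : Q ∈ scalarNehari)
    (hmin : IsMinOn scalarEnergy scalarNehari Q) (h : (u, v) ∈ nehariWide a β) :
    2 * normSq Q ≤ (a + β) * (normSq u + normSq v) := by
  obtain ⟨hne, hc⟩ := h
  rcases eq_or_ne u 0 with rfl | hu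
  · have hv : v ≠ 0 := by simpa using hne
    rw [normSq_zero, zero_add]
    exact two_mul_normSq_le_of_snd_eq_zero ha hle hQ hmin hc.swap hv
  rcases eq_or_ne v 0 with rfl | hv
  · rw [normSq_zero, add_zero]
    exact two_mul_normSq_le_of_snd_eq_zero ha hle hQ hmin hc hu
  · exact two_mul_normSq_le_of_mem_nehari ha (ha.le.trans hle) hQ hmin ⟨hu, hv, hc⟩

end NehariConstraints

section SynchronizedPairs

variable {a β r s : ℝ} {Q : L2}

lemma form_smul_eq_integral (hQ : IsScalarSolution Q) (hrs : a * r ^ 2 + β * s ^ 2 = 1) {w : L2}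
    (hw : w ∈ Hhalf) :
    form (r • Q) w = ∫ x : R3, (a * phi (r • Q) x * (r • Q : L2) x +
      β * phi (s • Q) x * (r • Q : L2) x) * w x := by
  rw [form_smul_left, hQ.2 w hw, ← integral_const_mul]
  refine integral_congr_ae ?_
  filter_upwards [Lp.coeFn_smul r Q] with x hx
  rw [hx, phi_smul, phi_smul, Pi.smul_apply, smul_eq_mul]
  linear_combination (-r * phi Q x * Q x * w x) * hrs

lemma isSystemSolution_smul (hQ : IsScalarSolution Q) (hrs : a * r ^ 2 + β * s ^ 2 = 1)
    (hsr : a * s ^ 2 + β * r ^ 2 = 1) : IsSystemSolution a β (r • Q, s • Q) :=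
  ⟨smul_mem_Hhalf r hQ.1, smul_mem_Hhalf s hQ.1, fun _ => form_smul_eq_integral hQ hrs,
    fun _ => form_smul_eq_integral hQ hsr⟩

lemma normSq_smul_eq_integral (hQ : normSq Q = D Q Q) (hrs : a * r ^ 2 + β * s ^ 2 = 1) :
    normSq (r • Q) = ∫ x : R3, (a * (phi (r • Q) x * (r • Q : L2) x ^ 2) +
      β * (phi (s • Q) x * (r • Q : L2) x ^ 2)) := by
  rw [normSq_smul, hQ, D, ← integral_const_mul]
  refine integral_congr_ae ?_
  filter_upwards [Lp.coeFn_smul r Q] with x hx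
  rw [hx, phi_smul, phi_smul, Pi.smul_apply, smul_eq_mul]
  linear_combination (-r ^ 2 * phi Q x * Q x ^ 2) * hrs

lemma nehariConstraints_smul (hQ_mem : Q ∈ Hhalf) (hQ : normSq Q = D Q Q)
    (hrs : a * r ^ 2 + β * s ^ 2 = 1) (hsr : a * s ^ 2 + β * r ^ 2 = 1) :
    NehariConstraints a β (r • Q, s • Q) :=
  ⟨smul_mem_Hhalf r hQ_mem, smul_mem_Hhalf s hQ_mem, normSq_smul_eq_integral hQ hrs,
    normSq_smul_eq_integral hQ hsr⟩

/-- Adding the two equations for `r²` and `s²` gives `(a + β) (r² + s²) = 2`, so the pair attains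
equality in the lower bound. -/
lemma J_smul_le (ha : 0 < a) (hβ : 0 ≤ β) (hQ_mem : Q ∈ Hhalf) (hQ : normSq Q = D Q Q)
    (hrs : a * r ^ 2 + β * s ^ 2 = 1) (hsr : a * s ^ 2 + β * r ^ 2 = 1) {u v : L2}
    (h : NehariConstraints a β (u, v))
    (hbound : 2 * normSq Q ≤ (a + β) * (normSq u + normSq v)) :
    J a β (r • Q, s • Q) ≤ J a β (u, v) := by
  rw [(nehariConstraints_smul hQ_mem hQ hrs hsr).J_eq ha hβ, h.J_eq ha hβ, normSq_smul,
    normSq_smul]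
  have hattained : (a + β) * (r ^ 2 * normSq Q + s ^ 2 * normSq Q) = 2 * normSq Q := by
    linear_combination normSq Q * (hrs + hsr)
  have hnormSq : r ^ 2 * normSq Q + s ^ 2 * normSq Q ≤ normSq u + normSq v :=
    le_of_mul_le_mul_left (hattained.trans_le hbound) (by positivity)
  linarith

end SynchronizedPairs

end Hartree

open Hartree

theorem lemma4p1_general (Q : L2) (hQ : IsScalarGroundState Q) (a β : ℝ) (ha : 0 < a)
    (hβ : 0 ≤ β) (k l : ℝ) (hk : 0 < k) (hl : 0 < l) (h1 : a * k + β * l = 1)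
    (h2 : a * l + β * k = 1) :
    IsGroundState a β (√k • Q, √l • Q) ∧
      (a ≤ β → IsMinOn (J a β) (nehariWide a β) (√k • Q, √l • Q)) := by
  obtain ⟨hsol, hQ_nehari, hQ_min⟩ := hQ
  obtain ⟨hQ_mem, hQ_ne, hQ_eq⟩ := id hQ_nehari
  rw [← Real.sq_sqrt hk.le, ← Real.sq_sqrt hl.le] at h1 h2
  refine ⟨⟨isSystemSolution_smul hsol h1 h2, ⟨?_, ?_, ?_⟩, ?_⟩, ?_⟩
  · exact smul_ne_zero (Real.sqrt_pos.2 hk).ne' hQ_ne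
  · exact smul_ne_zero (Real.sqrt_pos.2 hl).ne' hQ_ne
  · exact nehariConstraints_smul hQ_mem hQ_eq h1 h2
  · rintro ⟨u, v⟩ h
    exact J_smul_le ha hβ hQ_mem hQ_eq h1 h2 h.2.2
      (two_mul_normSq_le_of_mem_nehari ha hβ hQ_nehari hQ_min h)
  · rintro hle ⟨u, v⟩ h
    exact J_smul_le ha hβ hQ_mem hQ_eq h1 h2 h.2
      (two_mul_normSq_le_of_mem_nehariWide ha hle hQ_nehari hQ_min h)

theorem lemma4p1 (Q : Hartree.L2) (hQ : Hartree.IsScalarGroundState Q)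
    (a β : ℝ) (ha : 0 < a) (hβ : 0 < β) (hne : a ≠ β)
    (k l : ℝ) (hk : 0 < k) (hl : 0 < l)
    (h1 : a * k + β * l = 1) (h2 : a * l + β * k = 1) :
    Hartree.IsGroundState a β (Real.sqrt k • Q, Real.sqrt l • Q) ∧
      (a < β → IsMinOn (Hartree.J a β) (Hartree.nehariWide a β)
        (Real.sqrt k • Q, Real.sqrt l • Q)) :=
  (lemma4p1_general Q hQ a β ha hβ.le k l hk hl h1 h2).imp_right fun h hlt => h hlt.le
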